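/- Let $m\ge 2$ and let $N\subset\mathbf R^m$ be a nonempty closed subset. Let $d_N(p)=\inf_{q\in N}|p-q|$, let $\Sigma(N)$ be the set of all $p\in\mathbf R^m\setminus N$ at which $d_N$ is not differentiable, and let $\Sigma_2(N)$ be the set of all $p\in\Sigma(N)$ for which the set $\{q\in N : |p-q|=d_N(p)\}$ of nearest points has exactly two elements. A real-valued continuous function $u$ on an open set $\Omega\subset\mathbf R^d$ is called (locally) delta-convex (DC) if on every open convex set $\Omega'$ whose closure is a compact subset of $\Omega$ it is a difference of two convex functions; a map into $\mathbf R^k$ is DC if all its components are; a map on a relatively open subset of a $d$-dimensional affine subspace $P$ is DC if it is so after an isometric affine identification of $P$ with $\mathbf R^d$. For $1\le d\le m-1$, a set $S\subset\mathbf R^m$ is a $d$-dimensional DC submanifold if every $p\in S$ has an open neighborhood $U$ in $\mathbf R^m$ such that, for some $d$-dimensional affine subspace $P$ with orthogonal projection $\pi:\mathbf R^m\to P$, the image $\pi(S\cap U)$ is open in $P$, the restriction $\pi|_{S\cap U}$ is bi-Lipschitz, and its inverse $\pi(S\cap U)\to S\cap U\subset\mathbf R^m$ is a DC map. A $0$-dimensional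 DC submanifold is a single point. A DC hypersurface is an $(m-1)$-dimensional DC submanifold. Then there exist an at most countable family $\{S_j\}$ of DC hypersurfaces of $\mathbf R^m$ and an at most countable family $\{S'_j\}$ of $(m-2)$-dimensional DC submanifolds of $\mathbf R^m$ such that, with $S:=\bigcup_j S_j$, (i) $\Sigma_2(N)\subset S\subset\Sigma(N)$, and (ii) $\Sigma(N)\setminus S\subset\bigcup_j S'_j$. -/

import Mathlib

/-- A real function `u` is (locally) delta-convex on the open set `Ω ⊆ ℝᵈ`: it is continuous on `Ω`
and on every open convex set compactly embedded in `Ω` it is a difference of two convex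
functions. -/
def IsDCFunctionOn {d : ℕ} (Ω : Set (EuclideanSpace ℝ (Fin d)))
    (u : EuclideanSpace ℝ (Fin d) → ℝ) : Prop :=
  ContinuousOn u Ω ∧
    ∀ Ω' : Set (EuclideanSpace ℝ (Fin d)), IsOpen Ω' → Convex ℝ Ω' →
      IsCompact (closure Ω') → closure Ω' ⊆ Ω →
        ∃ g₁ g₂ : EuclideanSpace ℝ (Fin d) → ℝ,
          ConvexOn ℝ Ω' g₁ ∧ ConvexOn ℝ Ω' g₂ ∧ ∀ x ∈ Ω', u x = g₁ x - g₂ x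

/-- A map into `ℝᵏ` is (locally) delta-convex if every component is. -/
def IsDCMapOn {d k : ℕ} (Ω : Set (EuclideanSpace ℝ (Fin d)))
    (F : EuclideanSpace ℝ (Fin d) → EuclideanSpace ℝ (Fin k)) : Prop :=
  ∀ i : Fin k, IsDCFunctionOn Ω (fun x => F x i)

/-- A map `F`, defined on an open subset `Ω` of a `d`-dimensional affine subspace `P` of `ℝᵐ`, is
delta-convex if it is so after some isometric affine identification of `ℝᵈ` with `P`. (The choice
of the identification is immaterial, since delta-convexity is invariant under affine isometries
of `ℝᵈ`.) -/
def IsDCMapOnAffine {m k : ℕ} (d : ℕ) (P : AffineSubspace ℝ (EuclideanSpace ℝ (Fin m)))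
    [Nonempty P] (Ω : Set P) (F : P → EuclideanSpace ℝ (Fin k)) : Prop :=
  ∃ φ : EuclideanSpace ℝ (Fin d) ≃ᵃⁱ[ℝ] P, IsDCMapOn (φ ⁻¹' Ω) (F ∘ φ)

/-- The restriction of `f` to `A` is bi-Lipschitz. -/
def IsBiLipschitzOn {X Y : Type*} [MetricSpace X] [MetricSpace Y] (f : X → Y) (A : Set X) : Prop :=
  ∃ L : ℝ, 0 < L ∧ ∀ x ∈ A, ∀ y ∈ A,
    L⁻¹ * dist x y ≤ dist (f x) (f y) ∧ dist (f x) (f y) ≤ L * dist x y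

/-- A `d`-dimensional delta-convex submanifold `S` of `ℝᵐ`. For `d = 0` it is a point. For
`1 ≤ d ≤ m - 1`, every `p ∈ S` has an open neighbourhood `U` such that, for some `d`-dimensional
affine subspace `P`, the orthogonal projection to `P` is bi-Lipschitz on `S ∩ U` with relatively
open image, and the inverse `σ` of this restriction is a delta-convex map on that image. -/
def IsDCSubmanifold {m : ℕ} (d : ℕ) (S : Set (EuclideanSpace ℝ (Fin m))) : Prop :=
  (d = 0 ∧ ∃ p, S = {p}) ∨
  (1 ≤ d ∧ d + 1 ≤ m ∧
    ∀ p ∈ S, ∃ U : Set (EuclideanSpace ℝ (Fin m)), IsOpen U ∧ p ∈ U ∧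
      ∃ (P : AffineSubspace ℝ (EuclideanSpace ℝ (Fin m))) (_ : Nonempty P),
        Module.finrank ℝ P.direction = d ∧
        IsOpen (EuclideanGeometry.orthogonalProjection P '' (S ∩ U)) ∧
        IsBiLipschitzOn (EuclideanGeometry.orthogonalProjection P) (S ∩ U) ∧
        ∃ σ : P → EuclideanSpace ℝ (Fin m),
          (∀ x ∈ S ∩ U, σ (EuclideanGeometry.orthogonalProjection P x) = x) ∧
          IsDCMapOnAffine d P (EuclideanGeometry.orthogonalProjection P '' (S ∩ U)) σ)

/-- A delta-convex hypersurface of `ℝᵐ`: a delta-convex submanifold of codimension one. -/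
def IsDCHypersurface {m : ℕ} (S : Set (EuclideanSpace ℝ (Fin m))) : Prop :=
  IsDCSubmanifold (m - 1) S

/-- The singular set `Σ(N)`: the points off `N` where the distance function from `N` is not
differentiable. -/
def distSingularSet {m : ℕ} (N : Set (EuclideanSpace ℝ (Fin m))) :
    Set (EuclideanSpace ℝ (Fin m)) :=
  {p | p ∉ N ∧ ¬ DifferentiableAt ℝ (fun x => Metric.infDist x N) p}

/-- The set `π_N(p)` of the points of `N` nearest to `p`. -/
def nearestPoints {m : ℕ} (N : Set (EuclideanSpace ℝ (Fin m))) (p : EuclideanSpace ℝ (Fin m)) :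
    Set (EuclideanSpace ℝ (Fin m)) :=
  {q | q ∈ N ∧ Metric.infDist p N = dist q p}

/-- The set `Σ_k(N)` of the singular points that have exactly `k` nearest points in `N`. -/
def distSingularSetOfCard {m : ℕ} (k : ℕ) (N : Set (EuclideanSpace ℝ (Fin m))) :
    Set (EuclideanSpace ℝ (Fin m)) :=
  {p | p ∈ distSingularSet N ∧ (nearestPoints N p).encard = k}

/-! The function `powerFun K` is convex, and every nearest point of `K` is a subgradient of it. Let
compact pieces `K i` of `N` lie near the vertices of a `k`-simplex with direction `W`. For each `s`
near the centre of the simplex, `tiltedMax K s` has a sharp minimum on each fibre `p + W`, attained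
exactly at the point equidistant from all `K i` (`tiltedMax_add_le`, `mem_of_forall_le`). This
minimizer `H y` does not depend on `s`, so the equidistant set is a Lipschitz graph over `Wᗮ`.
Moreover `y ↦ tiltedMax K s (H y)` is a partial minimum of a convex function, hence convex.
Subtracting its values for `s` and `s + v` leaves `⟪v, H y⟫`, so every coordinate of `H` is a
difference of convex functions (`IsSimplicial.isDCSubmanifold`).

Cutting `N` by balls about a dense sequence gives countably many choices of pieces. Pairs of nearest
points yield hypersurfaces (`k = 1`). A singular point has at least two nearest points, and one
outside `Σ₂` has at least three; these lie on a sphere, so any three are affinely independent and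
yield codimension two (`k = 2`). -/

open Metric Filter Topology

/-! ### Convexity and subgradients of the power function. -/

section PowerFunction

variable {E : Type*} [NormedAddCommGroup E]

/-- The function `p ↦ (‖p‖² - dist(p, K)²) / 2`, the supremum over `a ∈ K` of the affine functions
`p ↦ ⟪a, p⟫ - ‖a‖² / 2`. -/
noncomputable def powerFun (K : Set E) (p : E) : ℝ := (‖p‖ ^ 2 - infDist p K ^ 2) / 2

theorem continuous_powerFun (K : Set E) : Continuous (powerFun K) := by
  unfold powerFun
  have := continuous_infDist_pt K
  fun_prop

theorem powerFun_eq_iff {K K' : Set E} {p : E} :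
    powerFun K p = powerFun K' p ↔ infDist p K = infDist p K' := by
  rw [← sq_eq_sq₀ (infDist_nonneg (s := K)) infDist_nonneg]
  unfold powerFun
  constructor <;> intro h <;> linarith

variable [InnerProductSpace ℝ E]

theorem le_powerFun {K : Set E} {a : E} (ha : a ∈ K) (p : E) :
    inner ℝ a p - ‖a‖ ^ 2 / 2 ≤ powerFun K p := by
  have h1 : infDist p K ^ 2 ≤ ‖p - a‖ ^ 2 := by
    rw [← dist_eq_norm]
    exact pow_le_pow_left₀ infDist_nonneg (infDist_le_dist_of_mem ha) 2
  rw [norm_sub_sq_real, real_inner_comm] at h1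
  unfold powerFun
  linarith

theorem powerFun_eq_of_infDist_eq {K : Set E} {a p : E} (h : infDist p K = dist p a) :
    powerFun K p = inner ℝ a p - ‖a‖ ^ 2 / 2 := by
  rw [powerFun, h, dist_eq_norm, norm_sub_sq_real, real_inner_comm]
  ring

theorem powerFun_add_inner_le {K : Set E} {a p : E} (ha : a ∈ K) (h : infDist p K = dist p a)
    (p' : E) : powerFun K p + inner ℝ a (p' - p) ≤ powerFun K p' := by
  rw [powerFun_eq_of_infDist_eq h, inner_sub_right]
  linarith [le_powerFun ha p']

theorem convexOn_powerFun {K : Set E} (hK : ∀ p, ∃ a ∈ K, infDist p K = dist p a) :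
    ConvexOn ℝ Set.univ (powerFun K) := by
  refine ⟨convex_univ, fun x _ y _ α β hα hβ hαβ => ?_⟩
  obtain ⟨a, ha, h⟩ := hK (α • x + β • y)
  rw [powerFun_eq_of_infDist_eq h, inner_add_right, inner_smul_right, inner_smul_right]
  have hx := mul_le_mul_of_nonneg_left (le_powerFun ha x) hα
  have hy := mul_le_mul_of_nonneg_left (le_powerFun ha y) hβ
  simp only [smul_eq_mul]
  have : ‖a‖ ^ 2 / 2 = α * (‖a‖ ^ 2 / 2) + β * (‖a‖ ^ 2 / 2) := by rw [← add_mul, hαβ, one_mul]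
  linarith

end PowerFunction

/-! ### Equidistant sets as fibrewise minimizers of tilted maxima. -/

section Equidistant

variable {E : Type*} [NormedAddCommGroup E] [InnerProductSpace ℝ E]
variable {ι : Type*}

/-- The set of the points that have the same distance from all the sets `K i`. -/
def equidistantSet (K : ι → Set E) : Set E := {p | ∀ i j, infDist p (K i) = infDist p (K j)}

/-- The sets `K i` lie near the vertices of a simplex with direction `W`, and every `s` in the ball
of radius `r` about `s₀` projects along `Wᗮ` into the interior of all the simplices with vertices
in the sets `K i`. -/
structure IsSimplicial (K : ι → Set E) (W : Submodule ℝ E) (s₀ : E) (r c : ℝ) : Prop where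
  isCompact : ∀ i, IsCompact (K i)
  nonempty : ∀ i, (K i).Nonempty
  radius_pos : 0 < r
  const_pos : 0 < c
  coercive : ∀ s ∈ ball s₀ r, ∀ a : ι → E, (∀ i, a i ∈ K i) → ∀ t ∈ W,
    ∃ i, c * ‖t‖ ≤ inner ℝ (a i - s) t
  descent : ∀ s ∈ ball s₀ r, ∀ i, ∃ w ∈ W, ∃ δ > 0, ∀ j ≠ i, ∀ a ∈ K j,
    inner ℝ (a - s) w ≤ -δ

theorem IsSimplicial.exists_infDist_eq {K : ι → Set E} {W : Submodule ℝ E} {s₀ : E} {r c : ℝ}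
    (h : IsSimplicial K W s₀ r c) (p : E) (i : ι) :
    ∃ a ∈ K i, infDist p (K i) = dist p a :=
  (h.isCompact i).exists_infDist_eq_dist (h.nonempty i) p

/-- A common point, used as every `a i`, would make `⟪p - s₀, w⟫` nonnegative by coercivity and
negative by descent. -/
theorem IsSimplicial.not_forall_mem [Nonempty ι] {K : ι → Set E} {W : Submodule ℝ E}
    {s₀ : E} {r c : ℝ} (h : IsSimplicial K W s₀ r c) (hι : ∀ i : ι, ∃ j, j ≠ i) {p : E} :
    ¬ ∀ i, p ∈ K i := by
  intro hp
  obtain ⟨i⟩ := ‹Nonempty ι›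
  have hs : s₀ ∈ ball s₀ r := mem_ball_self h.radius_pos
  obtain ⟨w, hw, δ, hδ, H⟩ := h.descent s₀ hs i
  obtain ⟨j, hj⟩ := hι i
  have h1 := H j hj p (hp j)
  obtain ⟨l, hl⟩ := h.coercive s₀ hs (fun _ => p) hp w hw
  have := mul_nonneg h.const_pos.le (norm_nonneg w)
  linarith

variable [Fintype ι] [Nonempty ι]

/-- The maximum of the functions `powerFun (K i)`, tilted by the linear function `⟪s, ·⟫`. -/
noncomputable def tiltedMax (K : ι → Set E) (s p : E) : ℝ :=
  (Finset.univ.sup' Finset.univ_nonempty fun i => powerFun (K i) p) - inner ℝ s p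

theorem powerFun_sub_inner_le_tiltedMax (K : ι → Set E) (s p : E) (i : ι) :
    powerFun (K i) p - inner ℝ s p ≤ tiltedMax K s p :=
  sub_le_sub_right (Finset.le_sup' (fun i => powerFun (K i) p) (Finset.mem_univ i)) _

theorem tiltedMax_le_iff {K : ι → Set E} {s p : E} {M : ℝ} :
    tiltedMax K s p ≤ M ↔ ∀ i, powerFun (K i) p - inner ℝ s p ≤ M := by
  simp [tiltedMax, Finset.sup'_le_iff]

theorem tiltedMax_lt_iff {K : ι → Set E} {s p : E} {M : ℝ} :
    tiltedMax K s p < M ↔ ∀ i, powerFun (K i) p - inner ℝ s p < M := by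
  simp [tiltedMax, Finset.sup'_lt_iff, sub_lt_iff_lt_add]

theorem continuous_tiltedMax (K : ι → Set E) (s : E) : Continuous (tiltedMax K s) := by
  unfold tiltedMax
  refine Continuous.sub ?_ (by fun_prop)
  exact Continuous.finset_sup'_apply _ fun i _ => continuous_powerFun _

theorem tiltedMax_add (K : ι → Set E) (s v p : E) :
    tiltedMax K (s + v) p = tiltedMax K s p - inner ℝ v p := by
  rw [tiltedMax, tiltedMax, inner_add_left]
  ring

theorem tiltedMax_eq_of_mem {K : ι → Set E} {s p : E} (hp : p ∈ equidistantSet K) (i : ι) :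
    tiltedMax K s p = powerFun (K i) p - inner ℝ s p := by
  refine le_antisymm (tiltedMax_le_iff.2 fun j => ?_) (powerFun_sub_inner_le_tiltedMax K s p i)
  rw [powerFun_eq_iff.2 (hp i j)]

namespace IsSimplicial

variable {K : ι → Set E} {W : Submodule ℝ E} {s₀ : E} {r c : ℝ}

theorem convexOn_tiltedMax (h : IsSimplicial K W s₀ r c) (s : E) :
    ConvexOn ℝ Set.univ (tiltedMax K s) := by
  refine ⟨convex_univ, fun x _ y _ α β hα hβ hαβ => tiltedMax_le_iff.2 fun i => ?_⟩
  have h1 := (convexOn_powerFun fun p => h.exists_infDist_eq p i).2 (Set.mem_univ x)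
    (Set.mem_univ y) hα hβ hαβ
  have hx := mul_le_mul_of_nonneg_left (powerFun_sub_inner_le_tiltedMax K s x i) hα
  have hy := mul_le_mul_of_nonneg_left (powerFun_sub_inner_le_tiltedMax K s y i) hβ
  simp only [smul_eq_mul, inner_add_right, inner_smul_right] at h1 ⊢
  linarith

/-- At an equidistant point all indices are active, so each nearest point gives a subgradient of the
maximum; coercivity selects one that grows along `t`. -/
theorem tiltedMax_add_le (h : IsSimplicial K W s₀ r c) {s : E} (hs : s ∈ ball s₀ r) {p t : E}
    (hp : p ∈ equidistantSet K) (ht : t ∈ W) :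
    tiltedMax K s p + c * ‖t‖ ≤ tiltedMax K s (p + t) := by
  choose a ha ha' using h.exists_infDist_eq p
  obtain ⟨i, hi⟩ := h.coercive s hs a ha t ht
  have h1 := powerFun_add_inner_le (ha i) (ha' i) (p + t)
  have h2 := powerFun_sub_inner_le_tiltedMax K s (p + t) i
  rw [tiltedMax_eq_of_mem hp i]
  rw [add_sub_cancel_left] at h1
  rw [inner_sub_left] at hi
  rw [inner_add_right] at h2
  linarith

theorem eq_zero_of_mem (h : IsSimplicial K W s₀ r c) {p t : E}
    (hp : p ∈ equidistantSet K) (ht : t ∈ W) (hpt : p + t ∈ equidistantSet K) : t = 0 := by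
  have hs : s₀ ∈ ball s₀ r := mem_ball_self h.radius_pos
  have h1 := h.tiltedMax_add_le hs hp ht
  have h2 := h.tiltedMax_add_le hs hpt (W.neg_mem ht)
  rw [add_neg_cancel_right, norm_neg] at h2
  have h3 : c * ‖t‖ ≤ 0 := by linarith
  have h4 := nonpos_of_mul_nonpos_right h3 h.const_pos
  exact norm_le_zero_iff.1 h4

/-- Since `z` minimizes on its fibre, this is the convexity of a partial minimum. -/
theorem tiltedMax_le_combo (h : IsSimplicial K W s₀ r c) {s : E} (hs : s ∈ ball s₀ r)
    {p q z : E} (hz : z ∈ equidistantSet K) {α β : ℝ} (hα : 0 ≤ α) (hβ : 0 ≤ β) (hαβ : α + β = 1)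
    (hW : α • p + β • q - z ∈ W) :
    tiltedMax K s z ≤ α * tiltedMax K s p + β * tiltedMax K s q := by
  have h1 := h.tiltedMax_add_le hs hz hW
  rw [add_sub_cancel] at h1
  have h2 := (h.convexOn_tiltedMax s).2 (Set.mem_univ p) (Set.mem_univ q) hα hβ hαβ
  have := mul_nonneg h.const_pos.le (norm_nonneg (α • p + β • q - z))
  simp only [smul_eq_mul] at h2
  linarith

theorem exists_tiltedMax_le_add (h : IsSimplicial K W s₀ r c) (s : E) :
    ∃ R : ℝ, 0 ≤ R ∧ ∀ p x : E, tiltedMax K s (p + x) ≤ tiltedMax K s p + R * ‖x‖ := by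
  obtain ⟨R, hR⟩ := (isCompact_iUnion h.isCompact).isBounded.exists_norm_le
  have hR0 : 0 ≤ R := by
    obtain ⟨i⟩ := ‹Nonempty ι›
    obtain ⟨a, ha⟩ := h.nonempty i
    exact (norm_nonneg a).trans (hR a (Set.mem_iUnion.2 ⟨i, ha⟩))
  refine ⟨R + ‖s‖, by positivity, fun p x => tiltedMax_le_iff.2 fun i => ?_⟩
  obtain ⟨a, ha, ha'⟩ := h.exists_infDist_eq (p + x) i
  have h1 := powerFun_add_inner_le ha ha' p
  have h2 := powerFun_sub_inner_le_tiltedMax K s p i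
  have h3 : inner ℝ a x ≤ R * ‖x‖ := (real_inner_le_norm a x).trans
    (mul_le_mul_of_nonneg_right (hR a (Set.mem_iUnion.2 ⟨i, ha⟩)) (norm_nonneg x))
  have h4 := neg_le_of_abs_le (abs_real_inner_le_norm s x)
  rw [sub_add_cancel_left, inner_neg_right] at h1
  rw [inner_add_right]
  linarith

/-- The equidistant set is a Lipschitz graph over `Wᗮ`. -/
theorem exists_norm_le_mul (h : IsSimplicial K W s₀ r c) :
    ∃ C : ℝ, 1 ≤ C ∧ ∀ p ∈ equidistantSet K, ∀ q ∈ equidistantSet K, ∀ x : E,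
      p - q - x ∈ W → ‖p - q‖ ≤ C * ‖x‖ := by
  obtain ⟨R, hR, H⟩ := h.exists_tiltedMax_le_add s₀
  have hs : s₀ ∈ ball s₀ r := mem_ball_self h.radius_pos
  have hc := h.const_pos
  refine ⟨R / c + 1, by linarith [div_nonneg hR hc.le], fun p hp q hq x hx => ?_⟩
  -- Compare `q` with `p - x` and `p` with `q + x`, which lie in the same fibres; adding the two
  -- inequalities cancels the values at `p` and `q`.
  have h1 := h.tiltedMax_add_le hs hq hx
  have h2 := h.tiltedMax_add_le hs hp (W.neg_mem hx)
  have h3 := H p (-x)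
  have h4 := H q x
  rw [show q + (p - q - x) = p + -x by abel] at h1
  rw [show p + -(p - q - x) = q + x by abel, norm_neg] at h2
  rw [norm_neg] at h3
  have h5 : ‖p - q - x‖ ≤ R * ‖x‖ / c := by
    rw [le_div_iff₀ hc]
    linarith
  calc ‖p - q‖ = ‖(p - q - x) + x‖ := by rw [sub_add_cancel]
    _ ≤ ‖p - q - x‖ + ‖x‖ := norm_add_le _ _
    _ ≤ R * ‖x‖ / c + ‖x‖ := by linarith
    _ = (R / c + 1) * ‖x‖ := by ring

/-- If index `i` were inactive at the minimum, a short step along its descent vector would lower all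
the other functions, while the `i`-th stays below the maximum by continuity. -/
theorem mem_of_forall_le (h : IsSimplicial K W s₀ r c) {p : E}
    (hp : ∀ t ∈ W, tiltedMax K s₀ p ≤ tiltedMax K s₀ (p + t)) : p ∈ equidistantSet K := by
  have hs : s₀ ∈ ball s₀ r := mem_ball_self h.radius_pos
  suffices H : ∀ i, tiltedMax K s₀ p ≤ powerFun (K i) p - inner ℝ s₀ p by
    intro i j
    rw [← powerFun_eq_iff]
    have hi := le_antisymm (H i) (powerFun_sub_inner_le_tiltedMax K s₀ p i)
    have hj := le_antisymm (H j) (powerFun_sub_inner_le_tiltedMax K s₀ p j)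
    linarith
  intro i
  by_contra! hlt
  obtain ⟨w, hw, δ, hδ, hdes⟩ := h.descent s₀ hs i
  have hcont : Continuous fun τ : ℝ => powerFun (K i) (p + τ • w) - inner ℝ s₀ (p + τ • w) := by
    have := continuous_powerFun (K i)
    fun_prop
  have hev : ∀ᶠ τ : ℝ in nhdsWithin 0 (Set.Ioi 0),
      powerFun (K i) (p + τ • w) - inner ℝ s₀ (p + τ • w) < tiltedMax K s₀ p := by
    refine (hcont.tendsto' 0 _ ?_).eventually_lt_const hlt |>.filter_mono nhdsWithin_le_nhds
    simp
  obtain ⟨τ, hτ, hτ0 : 0 < τ⟩ := (hev.and self_mem_nhdsWithin).exists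
  refine (hp (τ • w) (W.smul_mem τ hw)).not_gt (tiltedMax_lt_iff.2 fun j => ?_)
  by_cases hji : j = i
  · rwa [hji]
  obtain ⟨a, ha, ha'⟩ := h.exists_infDist_eq (p + τ • w) j
  have h1 := powerFun_add_inner_le ha ha' p
  have h2 := powerFun_sub_inner_le_tiltedMax K s₀ p j
  have h3 := mul_le_mul_of_nonneg_left (hdes j hji a ha) hτ0.le
  have h4 := mul_pos hτ0 hδ
  rw [inner_sub_left] at h3
  rw [sub_add_cancel_left, inner_neg_right, inner_smul_right] at h1
  rw [inner_add_right, inner_smul_right]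
  linarith

theorem exists_mem [FiniteDimensional ℝ E] (h : IsSimplicial K W s₀ r c) (p : E) :
    ∃ z ∈ equidistantSet K, z - p ∈ W := by
  have hs : s₀ ∈ ball s₀ r := mem_ball_self h.radius_pos
  have hcont : Continuous fun t : W => tiltedMax K s₀ (p + t) := by
    have := continuous_tiltedMax K s₀
    fun_prop
  choose a ha using h.nonempty
  obtain ⟨M, hM⟩ : ∃ M, ∀ i, M ≤ inner ℝ (a i) p - ‖a i‖ ^ 2 / 2 - inner ℝ s₀ p :=
    (Set.finite_range _).bddBelow.imp fun M hM i => hM (Set.mem_range_self i)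
  have hlow : ∀ t : W, c * ‖t‖ + M ≤ tiltedMax K s₀ (p + t) := by
    intro t
    obtain ⟨i, hi⟩ := h.coercive s₀ hs a ha t t.2
    have h1 := powerFun_sub_inner_le_tiltedMax K s₀ (p + t) i
    have h2 := le_powerFun (ha i) (p + t)
    have h3 := hM i
    rw [inner_sub_left] at hi
    rw [inner_add_right] at h1 h2
    rw [Submodule.coe_norm]
    linarith
  have htend : Filter.Tendsto (fun t : W => tiltedMax K s₀ (p + t)) (Filter.cocompact W)
      Filter.atTop := by
    refine Filter.tendsto_atTop_mono hlow (Filter.tendsto_atTop_add_const_right _ _ ?_)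
    exact (tendsto_norm_cocompact_atTop).const_mul_atTop h.const_pos
  obtain ⟨t, ht⟩ := hcont.exists_forall_le htend
  refine ⟨p + t, h.mem_of_forall_le fun u hu => ?_, by simp⟩
  simpa [add_assoc] using ht (t + ⟨u, hu⟩)

end IsSimplicial

end Equidistant

/-! ### Delta-convex parametrization of equidistant sets. -/

section Submanifold

theorem isDCFunctionOn_of_eq_sub {d : ℕ} {u g₁ g₂ : EuclideanSpace ℝ (Fin d) → ℝ}
    (hu : Continuous u) (h₁ : ConvexOn ℝ Set.univ g₁) (h₂ : ConvexOn ℝ Set.univ g₂)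
    (h : ∀ x, u x = g₁ x - g₂ x) (Ω : Set (EuclideanSpace ℝ (Fin d))) : IsDCFunctionOn Ω u :=
  ⟨hu.continuousOn, fun _ _ hΩ' _ _ => ⟨g₁, g₂, h₁.subset (Set.subset_univ _) hΩ',
    h₂.subset (Set.subset_univ _) hΩ', fun x _ => h x⟩⟩

theorem nonempty_affineIsometryEquiv_of_finrank_direction_eq {m d : ℕ}
    (P : AffineSubspace ℝ (EuclideanSpace ℝ (Fin m))) [hP : Nonempty P]
    (hd : Module.finrank ℝ P.direction = d) : Nonempty (EuclideanSpace ℝ (Fin d) ≃ᵃⁱ[ℝ] P) := by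
  obtain ⟨p₀⟩ := id hP
  subst hd
  exact ⟨(stdOrthonormalBasis ℝ P.direction).repr.symm.toAffineIsometryEquiv.trans
    (AffineIsometryEquiv.vaddConst ℝ p₀)⟩

variable {ι : Type*} [Fintype ι] [Nonempty ι]

theorem IsSimplicial.convexOn_tiltedMax_comp {E F : Type*} [NormedAddCommGroup E]
    [InnerProductSpace ℝ E] [AddCommGroup F] [Module ℝ F] {K : ι → Set E} {W : Submodule ℝ E}
    {s₀ : E} {r c : ℝ} (h : IsSimplicial K W s₀ r c) {s : E} (hs : s ∈ ball s₀ r) (f : F →ᵃ[ℝ] E)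
    {H : F → E} (hH : ∀ x, H x ∈ equidistantSet K) (hHf : ∀ x, H x - f x ∈ W) :
    ConvexOn ℝ Set.univ fun x => tiltedMax K s (H x) := by
  refine ⟨convex_univ, fun x _ y _ α β hα hβ hαβ => ?_⟩
  refine h.tiltedMax_le_combo hs (hH _) hα hβ hαβ ?_
  have h1 := W.sub_mem (W.add_mem (W.smul_mem α (hHf x)) (W.smul_mem β (hHf y)))
    (hHf (α • x + β • y))
  rw [Convex.combo_affine_apply hαβ] at h1
  convert h1 using 1
  module

theorem IsSimplicial.isDCSubmanifold {m d : ℕ} {K : ι → Set (EuclideanSpace ℝ (Fin m))}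
    {W : Submodule ℝ (EuclideanSpace ℝ (Fin m))} {s₀ : EuclideanSpace ℝ (Fin m)} {r c : ℝ}
    (h : IsSimplicial K W s₀ r c) (hd : 1 ≤ d) (hdm : d + 1 ≤ m)
    (hW : Module.finrank ℝ W + d = m) {U : Set (EuclideanSpace ℝ (Fin m))} (hU : IsOpen U) :
    IsDCSubmanifold d (equidistantSet K ∩ U) := by
  choose H hH hHW using h.exists_mem
  obtain ⟨C, hC1, hC⟩ := h.exists_norm_le_mul
  have hP : Nonempty Wᗮ.toAffineSubspace := ⟨⟨0, Wᗮ.zero_mem⟩⟩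
  set P := Wᗮ.toAffineSubspace with hPdef
  have hdir : P.direction = Wᗮ := Submodule.toAffineSubspace_direction _
  have hrank : Module.finrank ℝ P.direction = d := by
    have := W.finrank_add_finrank_orthogonal
    rw [finrank_euclideanSpace_fin] at this
    rw [hdir]
    omega
  have hdirW : P.directionᗮ = W := by rw [hdir, Submodule.orthogonal_orthogonal]
  have hπ : ∀ x, x - (EuclideanGeometry.orthogonalProjection P x : _) ∈ W := fun x => by
    have := EuclideanGeometry.vsub_orthogonalProjection_mem_direction_orthogonal P x
    rwa [hdirW] at this
  have hHπ : ∀ x ∈ equidistantSet K, H (EuclideanGeometry.orthogonalProjection P x) = x := by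
    intro x hx
    refine sub_eq_zero.1 (h.eq_zero_of_mem hx ?_ (by rw [add_sub_cancel]; exact hH _))
    have := W.sub_mem (hHW (EuclideanGeometry.orthogonalProjection P x)) (hπ x)
    rwa [sub_sub_sub_cancel_right] at this
  have hπH : ∀ y : P, EuclideanGeometry.orthogonalProjection P (H y) = y := by
    intro y
    rw [EuclideanGeometry.orthogonalProjection_eq_iff_mem, hdirW]
    exact hHW y
  have hLip : ∀ x y, ‖H x - H y‖ ≤ C * ‖x - y‖ := fun x y =>
    hC _ (hH x) _ (hH y) _ (by
      convert W.sub_mem (hHW x) (hHW y) using 1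
      abel)
  have hcont : Continuous H := by
    refine (LipschitzWith.of_dist_le_mul (K := C.toNNReal) fun x y => ?_).continuous
    rw [dist_eq_norm, dist_eq_norm, Real.coe_toNNReal _ (by linarith)]
    exact hLip x y
  refine Or.inr ⟨hd, hdm, fun p hp => ⟨U, hU, hp.2, P, hP, hrank, ?_, ⟨C, by linarith, ?_⟩,
    fun y => H y, fun x hx => hHπ x hx.1.1, ?_⟩⟩
  · have : EuclideanGeometry.orthogonalProjection P '' (equidistantSet K ∩ U ∩ U) =
        (fun y : P => H y) ⁻¹' U := by
      ext y
      constructor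
      · rintro ⟨x, ⟨⟨hx, hxU⟩, -⟩, rfl⟩
        simpa [hHπ x hx] using hxU
      · exact fun hy => ⟨H y, ⟨⟨hH _, hy⟩, hy⟩, hπH y⟩
    rw [this]
    exact hU.preimage (hcont.comp continuous_subtype_val)
  · intro x hx y hy
    have hle : dist (EuclideanGeometry.orthogonalProjection P x)
        (EuclideanGeometry.orthogonalProjection P y) ≤ dist x y := by
      have hxy := W.sub_mem (hπ x) (hπ y)
      set x' := EuclideanGeometry.orthogonalProjection P x
      set y' := EuclideanGeometry.orthogonalProjection P y
      have hort : inner ℝ ((x' : EuclideanSpace ℝ (Fin m)) - y') (x - x' - (y - y')) = 0 :=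
        Submodule.inner_left_of_mem_orthogonal hxy (Wᗮ.sub_mem x'.2 y'.2)
      have hpyth := norm_add_sq_eq_norm_sq_add_norm_sq_of_inner_eq_zero _ _ hort
      rw [show (x' : EuclideanSpace ℝ (Fin m)) - y' + (x - x' - (y - y')) = x - y by abel] at hpyth
      rw [Subtype.dist_eq, dist_eq_norm, dist_eq_norm]
      nlinarith [norm_nonneg (x - y), norm_nonneg ((x' : EuclideanSpace ℝ (Fin m)) - y'),
        mul_self_nonneg ‖x - x' - (y - y')‖]
    constructor
    · rw [inv_mul_le_iff₀ (by linarith), Subtype.dist_eq, dist_eq_norm, dist_eq_norm]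
      have := hLip (EuclideanGeometry.orthogonalProjection P x)
        (EuclideanGeometry.orthogonalProjection P y)
      rwa [hHπ x hx.1.1, hHπ y hy.1.1] at this
    · exact hle.trans (le_mul_of_one_le_left dist_nonneg hC1)
  · obtain ⟨φ⟩ := nonempty_affineIsometryEquiv_of_finrank_direction_eq P hrank
    refine ⟨φ, fun i => ?_⟩
    have hr := h.radius_pos
    -- Length `r / 2` keeps `s₀ + v` in the ball of admissible tilts; the factor `2 / r` below then
    -- turns `⟪v, H y⟫` into the `i`-th coordinate.
    set v : EuclideanSpace ℝ (Fin m) := EuclideanSpace.single i (r / 2)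
    have hs₀ : s₀ ∈ ball s₀ r := mem_ball_self hr
    have hv : s₀ + v ∈ ball s₀ r := by
      rw [mem_ball, dist_eq_norm, add_sub_cancel_left, PiLp.norm_single,
        Real.norm_of_nonneg (by linarith)]
      linarith
    let f : EuclideanSpace ℝ (Fin d) →ᵃ[ℝ] EuclideanSpace ℝ (Fin m) :=
      P.subtype.comp φ.toAffineEquiv.toAffineMap
    have hconv := fun s (hs : s ∈ ball s₀ r) =>
      (h.convexOn_tiltedMax_comp hs f (H := fun x => H (φ x)) (fun x => hH _)
        fun x => hHW _).smul (show 0 ≤ 2 / r by positivity)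
    refine isDCFunctionOn_of_eq_sub ?_ (hconv s₀ hs₀) (hconv (s₀ + v) hv) (fun x => ?_) _
    · have := φ.continuous
      fun_prop
    · simp only [Function.comp, smul_eq_mul, tiltedMax_add]
      rw [show inner ℝ v (H (φ x)) = r / 2 * H (φ x) i by
        simp [v, EuclideanSpace.inner_single_left]]
      field_simp
      ring

theorem IsSimplicial.equidistantSet_eq_singleton {E : Type*} [NormedAddCommGroup E]
    [InnerProductSpace ℝ E] [FiniteDimensional ℝ E] {K : ι → Set E} {s₀ : E} {r c : ℝ}
    (h : IsSimplicial K ⊤ s₀ r c) : ∃ p, equidistantSet K = {p} := by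
  obtain ⟨z, hz, -⟩ := h.exists_mem 0
  refine ⟨z, Set.eq_singleton_iff_unique_mem.2 ⟨hz, fun x hx => sub_eq_zero.1 ?_⟩⟩
  exact h.eq_zero_of_mem hz trivial (by rwa [add_sub_cancel])

end Submanifold

/-! ### Differentiability of the distance and uniqueness of nearest points. -/

section Differentiability

/-- The nearest points of `N` depend upper semicontinuously on the base point. -/
theorem eventually_forall_nearest_mem {X : Type*} [MetricSpace X] [ProperSpace X]
    {N V : Set X} {p : X} (hN : IsClosed N) (hV : IsOpen V)
    (h : ∀ q ∈ N, infDist p N = dist p q → q ∈ V) :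
    ∀ᶠ x in 𝓝 p, ∀ q ∈ N, infDist x N = dist x q → q ∈ V := by
  -- `L` is the compact part of `N` outside `V` that can matter near `p`. It is strictly farther
  -- from `p` than `N` is, and this persists nearby.
  set L := (N ∩ closedBall p (infDist p N + 2)) \ V
  have hL : IsCompact L :=
    (((isCompact_closedBall p _).inter_left hN).diff hV)
  have hclose : ∀ x ∈ ball p 1, ∀ q ∈ N, infDist x N = dist x q →
      q ∈ closedBall p (infDist p N + 2) := by
    intro x hx q _ hxq
    have h1 := infDist_le_infDist_add_dist (s := N) (x := x) (y := p)
    rw [mem_ball] at hx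
    rw [mem_closedBall, dist_comm]
    have := dist_triangle p x q
    rw [dist_comm p x] at this
    linarith
  rcases L.eq_empty_or_nonempty with hempty | hne
  · filter_upwards [ball_mem_nhds p one_pos] with x hx q hq hxq
    by_contra hqV
    have : q ∈ L := ⟨⟨hq, hclose x hx q hq hxq⟩, hqV⟩
    simp [hempty] at this
  · have hlt : infDist p N < infDist p L := by
      obtain ⟨q, hq, hpq⟩ := hL.exists_infDist_eq_dist hne p
      rw [hpq]
      exact lt_of_le_of_ne (infDist_le_dist_of_mem hq.1.1) fun heq => hq.2 (h q hq.1.1 heq)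
    have hev := (continuous_infDist_pt N).continuousAt.eventually_lt
      (continuous_infDist_pt L).continuousAt hlt
    filter_upwards [ball_mem_nhds p one_pos, hev] with x hx hxL q hq hxq
    by_contra hqV
    have hqL : q ∈ L := ⟨⟨hq, hclose x hx q hq hxq⟩, hqV⟩
    have := infDist_le_dist_of_mem hqL (x := x)
    linarith

variable {E : Type*} [NormedAddCommGroup E] [InnerProductSpace ℝ E]

/-- A derivative has norm at most `1` but takes the value `infDist p N` on both `p - a` and `p - b`,
which have that same norm; the parallelogram law then forces `a = b`. -/
theorem not_differentiableAt_infDist {N : Set E} {p a b : E} (hp : 0 < infDist p N)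
    (ha : a ∈ N) (hb : b ∈ N) (hpa : infDist p N = dist p a) (hpb : infDist p N = dist p b)
    (hab : a ≠ b) : ¬ DifferentiableAt ℝ (fun x => infDist x N) p := by
  intro hdiff
  set D := fderiv ℝ (fun x => infDist x N) p
  have hnorm : ‖D‖ ≤ 1 := by
    simpa using norm_fderiv_le_of_lipschitz ℝ (lipschitz_infDist_pt N) (x₀ := p)
  have key : ∀ q ∈ N, infDist p N = dist p q → infDist p N ≤ D (p - q) := by
    intro q hq hpq
    have hline : HasDerivAt (fun t : ℝ => infDist (p + t • (p - q)) N) (D (p - q)) 0 := by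
      have h1 : HasDerivAt (fun t : ℝ => p + t • (p - q)) (p - q) 0 := by
        simpa using ((hasDerivAt_id (0 : ℝ)).smul_const (p - q)).const_add p
      have h2 : HasFDerivAt (fun x => infDist x N) D (p + (0 : ℝ) • (p - q)) := by
        simpa using hdiff.hasFDerivAt
      exact h2.comp_hasDerivAt 0 h1
    -- Along the ray from `q` the distance is at most `(1 + t) * infDist p N`, with equality at `t =
    -- 0`, which determines the derivative.
    have hmin : ∀ᶠ t : ℝ in 𝓝 0, infDist (p + t • (p - q)) N - t * infDist p N ≤ infDist p N := by
      filter_upwards [lt_mem_nhds (show (-1 : ℝ) < 0 by norm_num)] with t ht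
      have h1 : infDist (p + t • (p - q)) N ≤ ‖(1 + t) • (p - q)‖ := by
        convert infDist_le_dist_of_mem hq (x := p + t • (p - q)) using 1
        rw [dist_eq_norm]
        congr 1
        module
      rw [norm_smul, Real.norm_of_nonneg (by linarith), ← dist_eq_norm, ← hpq] at h1
      linarith
    have hmax : IsLocalMax (fun t : ℝ => infDist (p + t • (p - q)) N - t * infDist p N) 0 := by
      filter_upwards [hmin] with t ht
      simpa using ht
    have := hmax.hasDerivAt_eq_zero
      (hline.sub ((hasDerivAt_id (0 : ℝ)).mul_const (infDist p N)))
    linarith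
  have h1 := key a ha hpa
  have h2 := key b hb hpb
  have h3 : infDist p N + infDist p N ≤ ‖(p - a) + (p - b)‖ := by
    calc infDist p N + infDist p N ≤ D ((p - a) + (p - b)) := by rw [map_add]; linarith
      _ ≤ ‖D ((p - a) + (p - b))‖ := Real.le_norm_self _
      _ ≤ ‖D‖ * ‖(p - a) + (p - b)‖ := D.le_opNorm _
      _ ≤ 1 * ‖(p - a) + (p - b)‖ := by gcongr
      _ = _ := one_mul _
  rw [dist_eq_norm] at hpa hpb
  have hpar := parallelogram_law_with_norm ℝ (p - a) (p - b)
  rw [← hpa, ← hpb, sub_sub_sub_cancel_left] at hpar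
  have h4 : 0 < ‖b - a‖ := norm_pos_iff.2 (sub_ne_zero.2 hab.symm)
  nlinarith

variable [ProperSpace E]

/-- The increment lies between its linearizations by the subgradient `a` at `p` and by a nearest
point `b` of `x`, and `b` tends to `a` by semicontinuity. -/
theorem hasFDerivAt_powerFun {N : Set E} {p a : E} (hN : IsClosed N) (ha : a ∈ N)
    (hpa : infDist p N = dist p a) (huniq : ∀ q ∈ N, infDist p N = dist p q → q = a) :
    HasFDerivAt (powerFun N) (innerSL ℝ a) p := by
  rw [hasFDerivAt_iff_isLittleO, Asymptotics.isLittleO_iff]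
  intro ε hε
  filter_upwards [eventually_forall_nearest_mem hN (isOpen_ball (x := a) (ε := ε))
    fun q hq hpq => by rw [huniq q hq hpq]; exact mem_ball_self hε] with x hx
  obtain ⟨b, hb, hxb⟩ := hN.exists_infDist_eq_dist ⟨a, ha⟩ x
  have h1 := powerFun_add_inner_le ha hpa x
  have h2 := powerFun_add_inner_le hb hxb p
  have h3 := mem_ball.1 (hx b hb hxb)
  have h4 : inner ℝ (b - a) (x - p) ≤ ε * ‖x - p‖ := by
    refine (real_inner_le_norm _ _).trans ?_
    rw [← dist_eq_norm b a]
    gcongr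
  rw [← neg_sub x p, inner_neg_right] at h2
  rw [inner_sub_left] at h4
  rw [innerSL_apply_apply, Real.norm_of_nonneg (by linarith)]
  linarith

theorem differentiableAt_infDist {N : Set E} {p a : E} (hN : IsClosed N) (hp : p ∉ N)
    (ha : a ∈ N) (hpa : infDist p N = dist p a)
    (huniq : ∀ q ∈ N, infDist p N = dist p q → q = a) :
    DifferentiableAt ℝ (fun x => infDist x N) p := by
  have h1 := (hasFDerivAt_powerFun hN ha hpa huniq).differentiableAt
  have h2 : (fun x => infDist x N) = fun x => Real.sqrt (‖x‖ ^ 2 - 2 * powerFun N x) := by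
    ext x
    rw [show ‖x‖ ^ 2 - 2 * powerFun N x = infDist x N ^ 2 by unfold powerFun; ring,
      Real.sqrt_sq infDist_nonneg]
  have h3 : 0 < infDist p N := (hN.notMem_iff_infDist_pos ⟨a, ha⟩).1 hp
  rw [h2]
  refine DifferentiableAt.sqrt ?_ ?_
  · exact (differentiableAt_id.norm_sq ℝ).sub (h1.const_mul 2)
  · unfold powerFun
    ring_nf
    positivity

end Differentiability

/-! ### Quantitative geometry of a nondegenerate simplex. -/

section Simplex

variable {E : Type*} [NormedAddCommGroup E] [InnerProductSpace ℝ E]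
variable {ι : Type*} [Fintype ι]

/-- The centroid of the points `q i`. -/
noncomputable def simplexCenter (q : ι → E) : E := (Fintype.card ι : ℝ)⁻¹ • ∑ i, q i

theorem sum_inner_sub_simplexCenter [Nonempty ι] (q : ι → E) (t : E) :
    ∑ i, inner ℝ (q i - simplexCenter q) t = 0 := by
  rw [← sum_inner, Finset.sum_sub_distrib, Finset.sum_const, Finset.card_univ, simplexCenter,
    ← Nat.cast_smul_eq_nsmul ℝ, smul_smul, mul_inv_cancel₀ (by simp), one_smul, sub_self,
    inner_zero_left]

theorem exists_mul_norm_le_inner_sub_simplexCenter [Nonempty ι] (q : ι → E) :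
    ∃ c > 0, ∀ t ∈ vectorSpan ℝ (Set.range q), ∃ i,
      c * ‖t‖ ≤ inner ℝ (q i - simplexCenter q) t := by
  set W := vectorSpan ℝ (Set.range q)
  let T : W →ₗ[ℝ] (ι → ℝ) :=
    LinearMap.pi fun i => (innerₗ E (q i - simplexCenter q)).comp W.subtype
  have hT : ∀ t i, T t i = inner ℝ (q i - simplexCenter q) (t : E) := fun t i => rfl
  have hker : LinearMap.ker T = ⊥ := by
    rw [LinearMap.ker_eq_bot']
    intro t ht
    have hle : W ≤ (Submodule.span ℝ {(t : E)})ᗮ := by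
      refine Submodule.span_le.2 ?_
      rintro _ ⟨_, ⟨i, rfl⟩, _, ⟨j, rfl⟩, rfl⟩
      refine Submodule.mem_orthogonal_singleton_iff_inner_left.2 ?_
      have hi := hT t i
      have hj := hT t j
      rw [ht, Pi.zero_apply, inner_sub_left] at hi hj
      simp only [vsub_eq_sub, inner_sub_left]
      linarith
    have := Submodule.mem_orthogonal_singleton_iff_inner_left.1 (hle t.2)
    exact Subtype.ext (inner_self_eq_zero.1 this)
  obtain ⟨k, hk, hanti⟩ := T.exists_antilipschitzWith hker
  have hk' : (0 : ℝ) < k := hk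
  set n : ℝ := (Fintype.card ι : ℝ) with hn
  have hn0 : 0 < n := by rw [hn]; exact_mod_cast Fintype.card_pos
  -- The products sum to zero, so if all are below `e` they are at most `n * e` in absolute value;
  -- the antilipschitz bound then gives `‖t‖ ≤ ‖t‖ / 2`.
  refine ⟨1 / (2 * n * k), by positivity, fun t ht => ?_⟩
  by_contra! hlt
  set e := 1 / (2 * n * k) * ‖t‖ with he
  have he0 : 0 ≤ e := by positivity
  have hsum : ∑ i, (e - inner ℝ (q i - simplexCenter q) t) = n * e := by
    rw [Finset.sum_sub_distrib, sum_inner_sub_simplexCenter]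
    simp [hn]
  have hn1 : 1 ≤ n := by rw [hn]; exact_mod_cast Fintype.card_pos
  have hbound : ‖T ⟨t, ht⟩‖ ≤ n * e := by
    refine (pi_norm_le_iff_of_nonneg (by positivity)).2 fun i => ?_
    rw [hT, Real.norm_eq_abs, abs_le]
    have h1 := Finset.single_le_sum (fun j _ => (sub_pos.2 (hlt j)).le) (Finset.mem_univ i)
    rw [hsum] at h1
    have h2 := hlt i
    have h3 := mul_le_mul_of_nonneg_right hn1 he0
    constructor <;> linarith
  have h1 : ‖t‖ ≤ k * ‖T ⟨t, ht⟩‖ := by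
    simpa using hanti.le_mul_dist ⟨t, ht⟩ 0
  have h2 : k * (n * e) = ‖t‖ / 2 := by
    rw [he]
    field_simp
  have h3 := mul_le_mul_of_nonneg_left hbound hk'.le
  have h4 : t = 0 := norm_le_zero_iff.1 (by linarith)
  obtain ⟨i⟩ := ‹Nonempty ι›
  have := hlt i
  simp [he, h4] at this

variable [FiniteDimensional ℝ E]

/-- The edges at `q i` are linearly independent, so some functional equals `-1` on all of them; `w`
is its Riesz vector projected to the span. -/
theorem AffineIndependent.exists_inner_sub_eq_neg_one {q : ι → E} (hq : AffineIndependent ℝ q)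
    (i : ι) : ∃ w ∈ vectorSpan ℝ (Set.range q), ∀ j ≠ i, inner ℝ (q j - q i) w = -1 := by
  have hli := (affineIndependent_iff_linearIndependent_vsub ℝ q i).1 hq
  obtain ⟨ℓ, hℓ⟩ := ((Module.Basis.span hli).constr ℝ fun _ => (-1 : ℝ)).exists_extend
  set W := vectorSpan ℝ (Set.range q)
  let w := (InnerProductSpace.toDual ℝ E).symm ℓ.toContinuousLinearMap
  refine ⟨W.starProjection w, W.starProjection_apply_mem w, fun j hj => ?_⟩
  have hmem : q j - q i ∈ W :=
    vsub_mem_vectorSpan ℝ (Set.mem_range_self j) (Set.mem_range_self i)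
  have h1 : inner ℝ (q j - q i) (w - W.starProjection w) = 0 :=
    Submodule.inner_right_of_mem_orthogonal hmem (W.sub_starProjection_mem_orthogonal w)
  rw [inner_sub_right, sub_eq_zero] at h1
  rw [← h1, real_inner_comm, InnerProductSpace.toDual_symm_apply]
  have h2 := LinearMap.congr_fun hℓ (Module.Basis.span hli ⟨j, hj⟩)
  rw [Module.Basis.constr_basis, LinearMap.comp_apply, Submodule.subtype_apply,
    Module.Basis.span_apply] at h2
  exact h2

theorem AffineIndependent.exists_inner_sub_simplexCenter_eq {q : ι → E}
    (hq : AffineIndependent ℝ q) (i : ι) : ∃ w ∈ vectorSpan ℝ (Set.range q), ∀ j ≠ i,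
      inner ℝ (q j - simplexCenter q) w = -(Fintype.card ι : ℝ)⁻¹ := by
  classical
  have : Nonempty ι := ⟨i⟩
  obtain ⟨w, hw, h⟩ := hq.exists_inner_sub_eq_neg_one i
  refine ⟨w, hw, fun j hj => ?_⟩
  have hterm : ∀ l, inner ℝ (q l - simplexCenter q) w =
      inner ℝ (q i - simplexCenter q) w + if l = i then 0 else -1 := by
    intro l
    split_ifs with hl
    · rw [hl, add_zero]
    · rw [← h l hl, ← inner_add_left]
      congr 1
      abel
  have hsum := sum_inner_sub_simplexCenter q w
  rw [Finset.sum_congr rfl fun l _ => hterm l] at hsum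
  have hsum' : ∑ l : ι, (if l = i then (0 : ℝ) else -1) = 1 - Fintype.card ι := by
    have : ∀ l, (if l = i then (0 : ℝ) else -1) = (if l = i then 1 else 0) - 1 := by
      intro l; split_ifs <;> simp
    simp_rw [this]
    simp
  rw [Finset.sum_add_distrib, hsum', Finset.sum_const, Finset.card_univ, nsmul_eq_mul] at hsum
  rw [hterm j, if_neg hj]
  have hn : (Fintype.card ι : ℝ) ≠ 0 := by simp
  field_simp
  linarith

/-- Compact sets near the vertices of a nondegenerate simplex are in simplicial position. -/
theorem AffineIndependent.exists_isSimplicial [Nonempty ι] {q : ι → E}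
    (hq : AffineIndependent ℝ q) :
    ∃ ε > 0, ∀ K : ι → Set E, (∀ i, IsCompact (K i)) → (∀ i, (K i).Nonempty) →
      (∀ i, K i ⊆ closedBall (q i) ε) →
        ∃ s₀ r c, IsSimplicial K (vectorSpan ℝ (Set.range q)) s₀ r c := by
  obtain ⟨c, hc, hcoer⟩ := exists_mul_norm_le_inner_sub_simplexCenter q
  choose w hw hw' using hq.exists_inner_sub_simplexCenter_eq
  have hn : (0 : ℝ) < Fintype.card ι := by exact_mod_cast Fintype.card_pos
  set δ : ℝ := (Fintype.card ι : ℝ)⁻¹ with hδ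
  have hδ0 : 0 < δ := by positivity
  set B : ℝ := ∑ i, ‖w i‖
  have hB : 0 ≤ B := by positivity
  -- The perturbation `2 * ε * ‖t‖` must cost at most half of `c * ‖t‖`, and at most `δ / 2` when `t
  -- = w i`.
  set ε := min (c / 4) (δ / (4 * (B + 1))) with hε
  have hε0 : 0 < ε := by positivity
  have hpert : ∀ i, ∀ a ∈ closedBall (q i) ε, ∀ s ∈ ball (simplexCenter q) ε, ∀ t : E,
      |inner ℝ (a - s) t - inner ℝ (q i - simplexCenter q) t| ≤ 2 * ε * ‖t‖ := by
    intro i a ha s hs t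
    rw [mem_closedBall, dist_eq_norm] at ha
    rw [mem_ball, dist_eq_norm] at hs
    rw [← inner_sub_left]
    refine (abs_real_inner_le_norm _ _).trans (mul_le_mul_of_nonneg_right ?_ (norm_nonneg t))
    rw [sub_sub_sub_comm]
    exact (norm_sub_le _ _).trans (by linarith)
  refine ⟨ε, hε0, fun K hK hKne hKq => ⟨simplexCenter q, ε, c / 2, hK, hKne, hε0, by positivity,
    fun s hs a ha t ht => ?_, fun s hs i => ?_⟩⟩
  · obtain ⟨i, hi⟩ := hcoer t ht
    refine ⟨i, ?_⟩
    have h1 := (abs_le.1 (hpert i (a i) (hKq i (ha i)) s hs t)).1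
    have h2 : 2 * ε * ‖t‖ ≤ c / 2 * ‖t‖ :=
      mul_le_mul_of_nonneg_right (by linarith [min_le_left (c / 4) (δ / (4 * (B + 1)))])
        (norm_nonneg t)
    linarith
  · refine ⟨w i, hw i, δ / 2, by positivity, fun j hj a ha => ?_⟩
    have h1 := (abs_le.1 (hpert j a (hKq j ha) s hs (w i))).2
    rw [hw' i j hj] at h1
    have h2 : ‖w i‖ ≤ B + 1 := by
      linarith [Finset.single_le_sum (fun l _ => norm_nonneg (w l)) (Finset.mem_univ i)]
    have h3 : 2 * ε * ‖w i‖ ≤ δ / 2 := by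
      calc 2 * ε * ‖w i‖ ≤ 2 * (δ / (4 * (B + 1))) * (B + 1) := by
            gcongr
            exact min_le_right _ _
        _ = δ / 2 := by field_simp; norm_num
    linarith

end Simplex

/-! ### Countable families of pieces and the singular set. -/

section SingularSet

/-- The part of `N` in the closed ball of radius `1 / (b.2 + 1)` about the `b.1`-th point of a dense
sequence. -/
noncomputable def ballPiece {m : ℕ} (N : Set (EuclideanSpace ℝ (Fin m))) (b : ℕ × ℕ) :
    Set (EuclideanSpace ℝ (Fin m)) :=
  N ∩ closedBall (TopologicalSpace.denseSeq (EuclideanSpace ℝ (Fin m)) b.1) (1 / (b.2 + 1))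

/-- The pieces of `N` chosen by `b` are in simplicial position, with `k`-dimensional direction. -/
def IsSimplicialIndex {m : ℕ} (k : ℕ) (N : Set (EuclideanSpace ℝ (Fin m)))
    (b : Fin (k + 1) → ℕ × ℕ) : Prop :=
  ∃ W s₀ r c, IsSimplicial (fun i => ballPiece N (b i)) W s₀ r c ∧ Module.finrank ℝ W = k

theorem infDist_eq_of_subset {X : Type*} [PseudoMetricSpace X] {N K : Set X} (hK : K ⊆ N) {x q : X}
    (hq : q ∈ K) (h : infDist x N = dist x q) : infDist x K = infDist x N :=
  le_antisymm (h ▸ infDist_le_dist_of_mem hq) (infDist_le_infDist_of_subset hK ⟨q, hq⟩)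

variable {m k : ℕ} {N : Set (EuclideanSpace ℝ (Fin m))}

theorem exists_isSimplicialIndex (hN : IsClosed N) {p : EuclideanSpace ℝ (Fin m)}
    {q : Fin (k + 1) → EuclideanSpace ℝ (Fin m)} (hq : AffineIndependent ℝ q)
    (hqN : ∀ i, q i ∈ N) (hpq : ∀ i, infDist p N = dist p (q i)) :
    ∃ b : Fin (k + 1) → ℕ × ℕ, IsSimplicialIndex k N b ∧
      p ∈ equidistantSet (fun i => ballPiece N (b i)) ∧ ∀ i, q i ∈
        ball (TopologicalSpace.denseSeq (EuclideanSpace ℝ (Fin m)) (b i).1) (1 / ((b i).2 + 1)) := by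
  obtain ⟨ε, hε, H⟩ := hq.exists_isSimplicial
  -- Radius below `ε / 2` puts any such ball containing `q i` inside `closedBall (q i) ε`.
  obtain ⟨n, hn⟩ := exists_nat_one_div_lt (half_pos hε)
  have hpos : (0 : ℝ) < 1 / (n + 1) := by positivity
  have hdense : ∀ i, ∃ l, dist (q i) (TopologicalSpace.denseSeq (EuclideanSpace ℝ (Fin m)) l) <
      1 / (n + 1 : ℝ) := fun i =>
    (TopologicalSpace.denseRange_denseSeq _).exists_dist_lt (q i) hpos
  choose l hl using hdense
  have hmem : ∀ i, q i ∈ ballPiece N (l i, n) := fun i => ⟨hqN i, (hl i).le⟩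
  refine ⟨fun i => (l i, n), ?_, fun i j => ?_, fun i => hl i⟩
  · obtain ⟨s₀, r, c, h⟩ := H (fun i => ballPiece N (l i, n))
      (fun i => (isCompact_closedBall _ _).inter_left hN) (fun i => ⟨q i, hmem i⟩) (by
        intro i x hx
        have h1 := dist_triangle_right x (q i)
          (TopologicalSpace.denseSeq (EuclideanSpace ℝ (Fin m)) (l i))
        have h2 := mem_closedBall.1 hx.2
        have h3 := hl i
        simp only at h2
        rw [mem_closedBall]
        linarith)
    exact ⟨_, s₀, r, c, h, hq.finrank_vectorSpan (Fintype.card_fin _)⟩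
  · exact (infDist_eq_of_subset Set.inter_subset_left (hmem i) (hpq i)).trans
      (infDist_eq_of_subset Set.inter_subset_left (hmem j) (hpq j)).symm

theorem eventually_exists_infDist_ballPiece_eq (hN : IsClosed N) (hne : N.Nonempty)
    {p : EuclideanSpace ℝ (Fin m)} {ι : Type*} {b : ι → ℕ × ℕ}
    (h : ∀ q ∈ N, infDist p N = dist p q → ∃ i, q ∈
      ball (TopologicalSpace.denseSeq (EuclideanSpace ℝ (Fin m)) (b i).1) (1 / ((b i).2 + 1))) :
    ∀ᶠ x in 𝓝 p, ∃ i, infDist x (ballPiece N (b i)) = infDist x N := by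
  filter_upwards [eventually_forall_nearest_mem hN (isOpen_iUnion fun i => isOpen_ball)
    fun q hq hpq => Set.mem_iUnion.2 (h q hq hpq)] with x hx
  obtain ⟨q, hq, hxq⟩ := hN.exists_infDist_eq_dist hne x
  obtain ⟨i, hi⟩ := Set.mem_iUnion.1 (hx q hq hxq)
  exact ⟨i, infDist_eq_of_subset Set.inter_subset_left ⟨hq, ball_subset_closedBall hi⟩ hxq⟩

/-- If one piece realises the distance to `N`, equidistance makes all of them do so. Their nearest
points cannot all coincide, as the pieces have no common point. -/
theorem mem_distSingularSet_of_isSimplicialIndex (hk : 1 ≤ k) {b : Fin (k + 1) → ℕ × ℕ}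
    (hb : IsSimplicialIndex k N b) {p : EuclideanSpace ℝ (Fin m)}
    (hp : p ∈ equidistantSet (fun i => ballPiece N (b i)))
    (hpN : ∃ i, infDist p (ballPiece N (b i)) = infDist p N) : p ∈ distSingularSet N := by
  obtain ⟨W, s₀, r, c, h, -⟩ := hb
  obtain ⟨i, hi⟩ := hpN
  choose a ha hpa using h.exists_infDist_eq p
  have hpa' : ∀ j, infDist p N = dist p (a j) := fun j => by rw [← hi, hp i j, hpa j]
  have : Nontrivial (Fin (k + 1)) := Fin.nontrivial_iff_two_le.2 (by omega)
  obtain ⟨j, hj⟩ : ∃ j, a j ≠ a i := by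
    by_contra! heq
    exact h.not_forall_mem exists_ne (p := a i) fun j => heq j ▸ ha j
  have hpos : 0 < infDist p N := by
    refine infDist_nonneg.lt_of_ne fun h0 => hj ?_
    have h1 := hpa' i
    have h2 := hpa' j
    rw [← h0, eq_comm, dist_eq_zero] at h1 h2
    rw [← h1, ← h2]
  exact ⟨fun hpN => hpos.ne' (infDist_zero_of_mem hpN),
    not_differentiableAt_infDist hpos (ha j).1 (ha i).1 (hpa' j) (hpa' i) hj⟩

theorem exists_ne_mem_nearestPoints (hN : IsClosed N) {p q : EuclideanSpace ℝ (Fin m)}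
    (hp : p ∈ distSingularSet N) (hq : q ∈ nearestPoints N p) : ∃ q' ∈ nearestPoints N p, q' ≠ q := by
  by_contra! h
  exact hp.2 (differentiableAt_infDist hN hp.1 hq.1 (by rw [hq.2, dist_comm])
    fun x hx hpx => h x ⟨hx, by rw [hpx, dist_comm]⟩)

end SingularSet

/-! ### Assembly of the two families. -/

theorem mainTheorem3 (m : ℕ) (hm : 2 ≤ m) (N : Set (EuclideanSpace ℝ (Fin m)))
    (hN : IsClosed N) (hne : N.Nonempty) :
    ∃ 𝒮 𝒮' : Set (Set (EuclideanSpace ℝ (Fin m))),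
      𝒮.Countable ∧ 𝒮'.Countable ∧
      (∀ S ∈ 𝒮, IsDCHypersurface S) ∧
      (∀ S' ∈ 𝒮', IsDCSubmanifold (m - 2) S') ∧
      (distSingularSetOfCard 2 N ⊆ ⋃₀ 𝒮 ∧ ⋃₀ 𝒮 ⊆ distSingularSet N) ∧
      distSingularSet N \ ⋃₀ 𝒮 ⊆ ⋃₀ 𝒮' := by
  -- The interior keeps the hypersurface relatively open and inside `Σ(N)`; the family `F'` only has
  -- to cover, so it needs no such restriction.
  let F : (Fin 2 → ℕ × ℕ) → Set (EuclideanSpace ℝ (Fin m)) := fun b =>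
    equidistantSet (fun i => ballPiece N (b i)) ∩
      interior {x | ∃ i, infDist x (ballPiece N (b i)) = infDist x N}
  let F' : (Fin 3 → ℕ × ℕ) → Set (EuclideanSpace ℝ (Fin m)) := fun b =>
    equidistantSet (fun i => ballPiece N (b i))
  have hcover : distSingularSetOfCard 2 N ⊆ ⋃₀ (F '' {b | IsSimplicialIndex 1 N b}) := by
    rintro p ⟨-, hcard⟩
    obtain ⟨x, y, hxy, hset⟩ := Set.encard_eq_two.1 hcard
    have hx : x ∈ nearestPoints N p := by rw [hset]; simp
    have hy : y ∈ nearestPoints N p := by rw [hset]; simp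
    obtain ⟨b, hb, hpb, hball⟩ := exists_isSimplicialIndex (p := p) (q := ![x, y]) hN
      (affineIndependent_of_ne ℝ hxy) (by simp [Fin.forall_fin_two, hx.1, hy.1])
      (by simp [Fin.forall_fin_two, dist_comm p, ← hx.2, ← hy.2])
    refine ⟨F b, ⟨b, hb, rfl⟩, hpb, mem_interior_iff_mem_nhds.2 ?_⟩
    refine eventually_exists_infDist_ballPiece_eq hN hne fun q hq hpq => ?_
    have hq' : q ∈ nearestPoints N p := ⟨hq, by rw [hpq, dist_comm]⟩
    rw [hset] at hq'
    rcases hq' with rfl | rfl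
    · exact ⟨0, hball 0⟩
    · exact ⟨1, hball 1⟩
  refine ⟨F '' {b | IsSimplicialIndex 1 N b}, F' '' {b | IsSimplicialIndex 2 N b},
    (Set.to_countable _).image _, (Set.to_countable _).image _, ?_, ?_, ⟨hcover, ?_⟩, ?_⟩
  · rintro _ ⟨b, ⟨W, s₀, r, c, h, hW⟩, rfl⟩
    exact h.isDCSubmanifold (by omega) (by omega) (by omega) isOpen_interior
  · rintro _ ⟨b, ⟨W, s₀, r, c, h, hW⟩, rfl⟩
    -- For `m = 2` the direction `W` is the whole plane, so there is one fibre and one equidistant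
    -- point.
    rcases hm.eq_or_lt with rfl | hlt
    · obtain rfl : W = ⊤ := Submodule.eq_top_of_finrank_eq (by rw [hW, finrank_euclideanSpace_fin])
      exact Or.inl ⟨rfl, h.equidistantSet_eq_singleton⟩
    · have := h.isDCSubmanifold (d := m - 2) (by omega) (by omega) (by omega) isOpen_univ
      rwa [Set.inter_univ] at this
  · rintro p ⟨_, ⟨b, hb, rfl⟩, hp, hpU⟩
    have hpU' := interior_subset hpU
    exact mem_distSingularSet_of_isSimplicialIndex le_rfl hb hp hpU'
  · rintro p ⟨hp, hpS⟩
    obtain ⟨x, hx, hpx⟩ := hN.exists_infDist_eq_dist hne p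
    rw [dist_comm] at hpx
    obtain ⟨y, hy, hyx⟩ := exists_ne_mem_nearestPoints hN hp (q := x) ⟨hx, hpx⟩
    obtain ⟨z, hz, hzx, hzy⟩ : ∃ z ∈ nearestPoints N p, z ≠ x ∧ z ≠ y := by
      by_contra! h
      refine hpS (hcover ⟨hp, Set.encard_eq_two.2 ⟨x, y, hyx.symm, ?_⟩⟩)
      ext z
      constructor
      · intro hz
        by_cases hzx : z = x
        · exact Or.inl hzx
        · exact Or.inr (h z hz hzx)
      · rintro (rfl | rfl)
        exacts [⟨hx, hpx⟩, hy]
    have hind : AffineIndependent ℝ ![x, y, z] := by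
      -- Nearest points lie on a sphere about `p`, and a line meets a sphere in at most two points.
      refine EuclideanGeometry.Cospherical.affineIndependent_of_ne ⟨p, infDist p N, ?_⟩ hyx.symm
        hzx.symm hzy.symm
      simp [← hpx, ← hy.2, ← hz.2]
    obtain ⟨b, hb, hpb, -⟩ := exists_isSimplicialIndex (p := p) hN hind
      (by simp [Fin.forall_fin_succ, hx, hy.1, hz.1])
      (by simp [Fin.forall_fin_succ, dist_comm p, ← hpx, ← hy.2, ← hz.2])
    exact ⟨F' b, ⟨b, hb, rfl⟩, hpb⟩
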